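/- Let $m,d\ge 1$ and let $A_0,\dots,A_{m-1}$ be complex $d\times d$ matrices such that $A_0=\mathbf u\mathbf v'$ for column vectors $\mathbf u,\mathbf v\in\mathbb C^d$ with $\mathbf v'\mathbf u\neq 0$ (where $'$ denotes the transpose, so that $\mathbf v'\mathbf u=\sum_j v_ju_j$ and $A_0$ has rank one), and such that $A_1,\dots,A_{m-1}$ are invertible. Let $\Omega=\{0,\dots,m-1\}^{\mathbb N}$ carry the product $\sigma$-algebra and let $\sigma:\Omega\to\Omega$, $(\sigma\omega)_n=\omega_{n+1}$, be the left shift. For a finite word $\mathbf w=w_1\cdots w_\ell$ over $\{0,\dots,m-1\}$ put $A_{\mathbf w}=A_{w_1}\cdots A_{w_\ell}$, and let $[\mathbf w]\subset\Omega$ be the cylinder of all sequences that have $\mathbf w$ as a prefix. Let $\mu$ be a $\sigma$-invariant and ergodic probability measure on $\Omega$ with $\mu([0])>0$, and let $\mathcal R$ be the set of all finite words $\mathbf w$ that do not contain the letter $0$ and satisfy $\mu([0\mathbf w0])>0$. Let $\|\cdot\|$ be any norm on the space of complex $d\times d$ matrices, and use the convention $\log 0=-\infty$. Then the series $$\sum_{\mathbf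 w\in\mathcal R}\mu([0\mathbf w0])\log\frac{|\mathbf v'A_{\mathbf w}\mathbf u|}{|\mathbf v'\mathbf u|}$$ converges unconditionally to a value in $[-\infty,+\infty)$, and for $\mu$-almost every $\omega\in\Omega$ the limit $$L(\omega)=\lim_{n\to\infty}\frac1n\log\|A_{\omega_0}A_{\omega_1}\cdots A_{\omega_{n-1}}\|$$ exists in $[-\infty,+\infty)$ and is equal to $$\mu([0])\log|\mathbf v'\mathbf u|+\sum_{\mathbf w\in\mathcal R}\mu([0\mathbf w0])\log\frac{|\mathbf v'A_{\mathbf w}\mathbf u|}{|\mathbf v'\mathbf u|}.$$ -/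

import Mathlib

open Filter Topology MeasureTheory

namespace RankOneLyapunov

/-- The extended logarithm of a nonnegative real number, with values in `[-∞, +∞)`:
it is the usual logarithm on `(0, +∞)`, and the logarithm of `0` is `-∞`. -/
noncomputable def elog (x : ℝ) : EReal := ENNReal.log (ENNReal.ofReal x)

/-- The left shift on the sequences with letters in `{0, …, m - 1}`. -/
def shift {m : ℕ} (ω : ℕ → Fin m) : ℕ → Fin m := fun n => ω (n + 1)

/-- The prefix `ω₀ ω₁ ⋯ ωₙ₋₁` of length `n` of a sequence. -/
def prefixWord {m : ℕ} (ω : ℕ → Fin m) (n : ℕ) : List (Fin m) := (List.range n).map ω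

/-- The cylinder `[w]`: all sequences that have the word `w` as a prefix. -/
def wordCylinder {m : ℕ} (w : List (Fin m)) : Set (ℕ → Fin m) :=
  {ω | prefixWord ω w.length = w}

/-- The word `0w0`. -/
def zeroWrap {m : ℕ} [NeZero m] (w : List (Fin m)) : List (Fin m) := 0 :: (w ++ [0])

/-- The matrix product `A_w = A_{w₁} ⋯ A_{w_ℓ}` along the word `w = w₁ ⋯ w_ℓ`, in this order. -/
def wordProd {m d : ℕ} (A : Fin m → Matrix (Fin d) (Fin d) ℂ) (w : List (Fin m)) :
    Matrix (Fin d) (Fin d) ℂ := (w.map A).prod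

/-- The Lyapunov exponent of `(A_{ω_n})`, computed with the norm `N`, exists in `[-∞, +∞]` and
equals `L`: that is, `(1/n) log N(A_{ω₀} ⋯ A_{ω_{n-1}})` tends to `L`, where `log 0 = -∞`. -/
def HasLyapunovExponent {m d : ℕ} (N : Seminorm ℂ (Matrix (Fin d) (Fin d) ℂ))
    (A : Fin m → Matrix (Fin d) (Fin d) ℂ) (ω : ℕ → Fin m) (L : EReal) : Prop :=
  Tendsto (fun n : ℕ => elog (N (wordProd A (prefixWord ω n))) / (n : EReal)) atTop (𝓝 L)

/-- The set `R` of all words `w` that do not contain `0` and satisfy `μ([0w0]) > 0`. -/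
def returnWords {m : ℕ} [NeZero m] (μ : Measure (ℕ → Fin m)) : Set (List (Fin m)) :=
  {w | (0 : Fin m) ∉ w ∧ 0 < μ (wordCylinder (zeroWrap w))}

end RankOneLyapunov

open RankOneLyapunov

/-! Since `A 0` equals u v', every block between consecutive zeros collapses to a scalar: A₀ A_w A₀
= (v' A_w u) A₀. Up to the stretch before the first zero and the stretch after the last one, a long
product is therefore a product of the scalars v' A_w u over the successive return words w. Its
logarithm is a Birkhoff sum for the shift of the function equal to log|v' A_w u| on [0w0] and 0 off
[0]. `zeroVec` and `zeroCocycle` express this without enumerating return times, so the ergodic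
theorem is applied to the shift itself (`wordProd_prefixWord_eq`).

The boundary terms do not matter. Zeros have frequency μ([0]) > 0, so the last zero before n lies at
n - o(n) (`tendsto_lastZero_div`). The remaining matrices are invertible, so they change the norm by
a factor between C^(-o(n)) and C^(o(n)).

The return word has mass μ([0w0]) at w, so space averages are the sums in the theorem; the total
mass μ([0]) accounts for the term in log|v'u|. The positive part of log|v' A_w u| is at most linear
in the length of w, hence integrable by Kac's bound. The negative part need not be integrable, so
the logarithm is truncated at -M. If the truncated integrals tend to -∞, the upper bounds alone make
both the series and the exponent -∞. Otherwise the logarithm is integrable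
(`pos_and_integrable_log`) and matching upper and lower bounds hold. -/

/-! ### The pointwise ergodic theorem, by a maximal function argument. -/

section Birkhoff

variable {X : Type*}

/-- The maximum of the Birkhoff sums of `f` of lengths `1, …, n + 1`. -/
def birkhoffMax (T : X → X) (f : X → ℝ) : ℕ → X → ℝ
  | 0 => f
  | n + 1 => fun x => f x + max 0 (birkhoffMax T f n (T x))

theorem birkhoffMax_le_succ (T : X → X) (f : X → ℝ) (n : ℕ) (x : X) :
    birkhoffMax T f n x ≤ birkhoffMax T f (n + 1) x := by
  induction n generalizing x with
  | zero => simp [birkhoffMax]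
  | succ n ih =>
    have := ih (T x)
    rw [birkhoffMax, birkhoffMax]
    exact add_le_add_right (max_le_max le_rfl this) _

theorem birkhoffMax_monotone (T : X → X) (f : X → ℝ) (x : X) :
    Monotone fun n => birkhoffMax T f n x :=
  monotone_nat_of_le_succ fun n => birkhoffMax_le_succ T f n x

theorem birkhoffSum_le_birkhoffMax (T : X → X) (f : X → ℝ) (n : ℕ) (x : X) :
    birkhoffSum T f (n + 1) x ≤ birkhoffMax T f n x := by
  induction n generalizing x with
  | zero => simp [birkhoffMax]
  | succ n ih =>
    rw [birkhoffSum_succ', birkhoffMax]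
    exact add_le_add_right ((ih (T x)).trans (le_max_right _ _)) _

theorem birkhoffSum_add_const {T : X → X} (f : X → ℝ) (a : ℝ) (n : ℕ) (x : X) :
    birkhoffSum T (fun y => f y + a) n x = birkhoffSum T f n x + n * a := by
  simp [birkhoffSum, Finset.sum_add_distrib]

variable [MeasurableSpace X]

theorem measurable_birkhoffMax {T : X → X} {f : X → ℝ} (hT : Measurable T) (hf : Measurable f)
    (n : ℕ) : Measurable (birkhoffMax T f n) := by
  induction n with
  | zero => exact hf
  | succ n ih => exact hf.add (measurable_const.max (ih.comp hT))

theorem integrable_birkhoffMax {μ : Measure X} {T : X → X} {f : X → ℝ}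
    (hT : MeasurePreserving T μ μ) (hf : Integrable f μ) (n : ℕ) :
    Integrable (birkhoffMax T f n) μ := by
  induction n with
  | zero => exact hf
  | succ n ih =>
    have h : Integrable (fun x => max 0 (birkhoffMax T f n (T x))) μ :=
      (integrable_zero X ℝ μ).sup (hT.integrable_comp_of_integrable ih)
    exact hf.add h

/-- If `f` has negative integral, then almost all orbits have Birkhoff sums bounded above. -/
theorem Ergodic.ae_birkhoffSum_bddAbove {μ : Measure X} {T : X → X} {f : X → ℝ}
    (hT : Ergodic T μ) (hfm : Measurable f) (hf : Integrable f μ) (hneg : ∫ x, f x ∂μ < 0) :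
    ∀ᵐ x ∂μ, ∃ B : ℝ, ∀ n, birkhoffSum T f n x ≤ B := by
  have hTm : Measurable T := hT.toMeasurePreserving.measurable
  -- The set where the running maxima are unbounded. The recursion for `birkhoffMax` makes it
  -- invariant, so it is null or conull.
  set A : Set X := {x | ∀ K : ℕ, ∃ n, (K : ℝ) < birkhoffMax T f n x} with hA
  have hAm : MeasurableSet A := by
    have : A = ⋂ K : ℕ, ⋃ n : ℕ, {x | (K : ℝ) < birkhoffMax T f n x} := by
      ext x; simp [hA]
    rw [this]
    exact MeasurableSet.iInter fun K => MeasurableSet.iUnion fun n =>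
      measurableSet_lt measurable_const (measurable_birkhoffMax hTm hfm n)
  have hinv : T ⁻¹' A = A := by
    ext x
    simp only [hA, Set.mem_preimage, Set.mem_ofPred_eq]
    constructor
    · intro h K
      obtain ⟨K', hK'⟩ := exists_nat_gt ((K : ℝ) - f x)
      obtain ⟨n, hn⟩ := h K'
      refine ⟨n + 1, ?_⟩
      rw [birkhoffMax]
      linarith [le_max_right 0 (birkhoffMax T f n (T x))]
    · intro h K
      obtain ⟨K', hK'⟩ := exists_nat_gt ((K : ℝ) + f x)
      obtain ⟨n, hn⟩ := h K'
      have h2 := hn.trans_le (birkhoffMax_le_succ T f n x)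
      rw [birkhoffMax] at h2
      refine ⟨n, ?_⟩
      by_contra! h3
      have : max 0 (birkhoffMax T f n (T x)) ≤ K := max_le (Nat.cast_nonneg K) h3
      linarith
  rcases hT.toPreErgodic.ae_mem_or_ae_notMem hAm hinv with h | h
  · exfalso
    -- If `A` is conull, write g n = M (n+1) - M n ∘ T with M the running maximum. Invariance of μ
    -- and monotonicity of M give ∫ g n ≥ 0. But M n ∘ T is eventually positive on `A`, so g n is
    -- eventually f there, and dominated convergence yields ∫ f ≥ 0.
    set g : ℕ → X → ℝ := fun n x => f x + max 0 (-(birkhoffMax T f n (T x))) with hg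
    have hgeq : ∀ n x, g n x = birkhoffMax T f (n + 1) x - birkhoffMax T f n (T x) := by
      intro n x
      simp only [hg, birkhoffMax]
      rcases le_total 0 (birkhoffMax T f n (T x)) with h | h
      · rw [max_eq_left (by linarith), max_eq_right h]; ring
      · rw [max_eq_right (by linarith), max_eq_left h]; ring
    have hcomp : ∀ n, Integrable (fun x => birkhoffMax T f n (T x)) μ := fun n =>
      hT.toMeasurePreserving.integrable_comp_of_integrable
        (integrable_birkhoffMax hT.toMeasurePreserving hf n)
    have hpos : ∀ n, 0 ≤ ∫ x, g n x ∂μ := by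
      intro n
      have h1 : ∫ x, birkhoffMax T f n (T x) ∂μ = ∫ x, birkhoffMax T f n x ∂μ := by
        conv_rhs => rw [← hT.toMeasurePreserving.map_eq]
        rw [integral_map hTm.aemeasurable
          (measurable_birkhoffMax hTm hfm n).aestronglyMeasurable]
      simp_rw [hgeq]
      rw [integral_sub (integrable_birkhoffMax hT.toMeasurePreserving hf (n + 1)) (hcomp n), h1,
        sub_nonneg]
      exact integral_mono (integrable_birkhoffMax hT.toMeasurePreserving hf n)
        (integrable_birkhoffMax hT.toMeasurePreserving hf (n + 1))
        fun x => birkhoffMax_le_succ T f n x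
    have hlim : Tendsto (fun n => ∫ x, g n x ∂μ) atTop (𝓝 (∫ x, f x ∂μ)) := by
      refine tendsto_integral_of_dominated_convergence (fun x => |f x| + |f (T x)|) ?_ ?_ ?_ ?_
      · intro n
        exact (hfm.add (measurable_const.max
          ((measurable_birkhoffMax hTm hfm n).comp hTm).neg)).aestronglyMeasurable
      · exact hf.abs.add (hT.toMeasurePreserving.integrable_comp_of_integrable hf).abs
      · intro n
        refine Eventually.of_forall fun x => ?_
        have h1 : f (T x) ≤ birkhoffMax T f n (T x) := birkhoffMax_monotone T f (T x) n.zero_le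
        have h2 : |max 0 (-(birkhoffMax T f n (T x)))| ≤ |f (T x)| := by
          rw [abs_of_nonneg (le_max_left _ _)]
          exact max_le (abs_nonneg _) (by linarith [neg_le_abs (f (T x))])
        exact (abs_add_le _ _).trans (by linarith)
      · filter_upwards [h] with x hx
        have hx' : T x ∈ A := by rw [← hinv] at hx; exact hx
        obtain ⟨n, hn⟩ := hx' 0
        refine tendsto_const_nhds.congr' ?_
        filter_upwards [eventually_ge_atTop n] with k hk
        have := birkhoffMax_monotone T f (T x) hk
        simp only at this
        simp only [hg]
        rw [max_eq_left, add_zero]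
        push_cast at hn
        linarith
    exact absurd (ge_of_tendsto' hlim hpos) (not_le.2 hneg)
  · filter_upwards [h] with x hx
    simp only [hA, Set.mem_ofPred_eq, not_forall, not_exists, not_lt] at hx
    obtain ⟨K, hK⟩ := hx
    refine ⟨K, fun n => ?_⟩
    cases n with
    | zero => simp
    | succ n => exact (birkhoffSum_le_birkhoffMax T f n x).trans (hK n)

/-- Subtracting ∫ f + 1/(k+1) makes the integral negative, so the shifted sums are bounded above and
the bound vanishes after division by n. Countably many k suffice for every b. -/
theorem Ergodic.ae_eventually_birkhoffSum_div_lt {μ : Measure X} [IsProbabilityMeasure μ]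
    {T : X → X} {f : X → ℝ} (hT : Ergodic T μ) (hfm : Measurable f) (hf : Integrable f μ) :
    ∀ᵐ x ∂μ, ∀ b > ∫ x, f x ∂μ, ∀ᶠ n : ℕ in atTop, birkhoffSum T f n x / n < b := by
  have key : ∀ k : ℕ, ∀ᵐ x ∂μ, ∃ B : ℝ, ∀ n,
      birkhoffSum T (fun y => f y + -(∫ x, f x ∂μ + 1 / (k + 1))) n x ≤ B := by
    intro k
    refine hT.ae_birkhoffSum_bddAbove (hfm.add_const _) (hf.add (integrable_const _)) ?_
    rw [integral_add hf (integrable_const _)]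
    have : (0 : ℝ) < 1 / (k + 1) := by positivity
    simp only [integral_const, probReal_univ, one_smul]
    linarith
  filter_upwards [ae_all_iff.2 key] with x hx b hb
  obtain ⟨k, hk⟩ := exists_nat_one_div_lt (sub_pos.2 hb)
  obtain ⟨B, hB⟩ := hx k
  have hlim : Tendsto (fun n : ℕ => B / n + (∫ x, f x ∂μ + 1 / ((k : ℝ) + 1))) atTop
      (𝓝 (0 + (∫ x, f x ∂μ + 1 / ((k : ℝ) + 1)))) :=
    (tendsto_const_div_atTop_nhds_zero_nat B).add tendsto_const_nhds
  filter_upwards [hlim.eventually_lt_const (show _ < b by linarith), eventually_gt_atTop 0]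
    with n hn hn0
  refine lt_of_le_of_lt ?_ hn
  have hn0' : (0 : ℝ) < n := Nat.cast_pos.2 hn0
  have := hB n
  rw [birkhoffSum_add_const] at this
  rw [div_le_iff₀ hn0', add_mul, div_mul_cancel₀ _ hn0'.ne']
  linarith

/-- **Birkhoff's pointwise ergodic theorem**, for ergodic probability-preserving maps. -/
theorem Ergodic.ae_tendsto_birkhoffSum_div {μ : Measure X} [IsProbabilityMeasure μ]
    {T : X → X} {f : X → ℝ} (hT : Ergodic T μ) (hfm : Measurable f) (hf : Integrable f μ) :
    ∀ᵐ x ∂μ, Tendsto (fun n : ℕ => birkhoffSum T f n x / n) atTop (𝓝 (∫ x, f x ∂μ)) := by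
  filter_upwards [hT.ae_eventually_birkhoffSum_div_lt hfm hf,
    hT.ae_eventually_birkhoffSum_div_lt hfm.neg hf.neg] with x h1 h2
  rw [tendsto_order]
  refine ⟨fun a ha => ?_, fun b hb => h1 b hb⟩
  have := h2 (-a) (by simp only [Pi.neg_apply, integral_neg]; linarith)
  filter_upwards [this] with n hn
  rw [birkhoffSum_neg, neg_div] at hn
  linarith

end Birkhoff

/-! ### Return words to the letter 0 and their distribution. -/

section Words

variable {m : ℕ}

@[simp] theorem length_prefixWord (ω : ℕ → Fin m) (n : ℕ) : (prefixWord ω n).length = n := by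
  simp [prefixWord]

theorem iterate_shift_apply (ω : ℕ → Fin m) (k n : ℕ) : shift^[k] ω n = ω (n + k) := by
  induction k generalizing ω with
  | zero => rfl
  | succ k ih => rw [Function.iterate_succ_apply, ih, shift]; congr 1

theorem prefixWord_add (ω : ℕ → Fin m) (a b : ℕ) :
    prefixWord ω (a + b) = prefixWord ω a ++ prefixWord (shift^[a] ω) b := by
  simp only [prefixWord, List.range_add, List.map_append, List.map_map]
  congr 1
  refine List.map_congr_left fun k _ => ?_
  rw [iterate_shift_apply, Function.comp_apply, add_comm]

theorem prefixWord_succ (ω : ℕ → Fin m) (n : ℕ) :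
    prefixWord ω (n + 1) = ω 0 :: prefixWord (shift ω) n := by
  rw [add_comm, prefixWord_add]; rfl

theorem mem_prefixWord {ω : ℕ → Fin m} {n : ℕ} {a : Fin m} :
    a ∈ prefixWord ω n ↔ ∃ k < n, ω k = a := by
  simp [prefixWord]

theorem prefixWord_eq_append_singleton {ω : ℕ → Fin m} {w : List (Fin m)} {a : Fin m} :
    prefixWord ω (w ++ [a]).length = w ++ [a] ↔ prefixWord ω w.length = w ∧ ω w.length = a := by
  rw [List.length_append, List.length_singleton, prefixWord_add]
  have : prefixWord (shift^[w.length] ω) 1 = [ω w.length] := by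
    simp [prefixWord, iterate_shift_apply]
  rw [this]
  constructor
  · intro h
    have := List.append_inj h (length_prefixWord _ _)
    exact ⟨this.1, by simpa using this.2⟩
  · rintro ⟨h1, h2⟩
    rw [h1, h2]

theorem measurable_shift : Measurable (shift : (ℕ → Fin m) → ℕ → Fin m) :=
  measurable_pi_lambda _ fun n => measurable_pi_apply (n + 1)

theorem measurableSet_apply_eq (n : ℕ) (a : Fin m) : MeasurableSet {ω : ℕ → Fin m | ω n = a} :=
  (measurable_pi_apply (X := fun _ => Fin m) n) (measurableSet_singleton a)

theorem measurableSet_prefixWord_eq (n : ℕ) (w : List (Fin m)) :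
    MeasurableSet {ω : ℕ → Fin m | prefixWord ω n = w} := by
  have : {ω : ℕ → Fin m | prefixWord ω n = w}
      = (fun ω (k : Fin n) => ω k) ⁻¹' {x | List.ofFn x = w} := by
    ext ω
    simp only [prefixWord, Set.mem_preimage, Set.mem_ofPred_eq]
    rw [List.ofFn_eq_map, ← List.map_coe_finRange_eq_range, List.map_map]
    rfl
  rw [this]
  exact (measurable_pi_lambda _ fun k => measurable_pi_apply _) (Set.toFinite _).measurableSet

variable [NeZero m]

theorem mem_wordCylinder_zero {ω : ℕ → Fin m} : ω ∈ wordCylinder [(0 : Fin m)] ↔ ω 0 = 0 := by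
  simp [wordCylinder, prefixWord]

theorem measurableSet_wordCylinder_zero : MeasurableSet (wordCylinder [(0 : Fin m)]) :=
  measurableSet_prefixWord_eq _ _

theorem mem_wordCylinder_zeroWrap {ω : ℕ → Fin m} {w : List (Fin m)} :
    ω ∈ wordCylinder (zeroWrap w) ↔
      ω 0 = 0 ∧ prefixWord (shift ω) w.length = w ∧ shift ω w.length = 0 := by
  rw [wordCylinder, Set.mem_ofPred_eq, zeroWrap, List.length_cons, prefixWord_succ, List.cons.injEq,
    prefixWord_eq_append_singleton]

/-- The index of the first letter `0` of `ω` (and `0` if there is none). -/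
noncomputable def firstZero (ω : ℕ → Fin m) : ℕ := sInf {n | ω n = 0}

theorem apply_firstZero {ω : ℕ → Fin m} {n : ℕ} (h : ω n = 0) : ω (firstZero ω) = 0 :=
  Nat.sInf_mem (s := {n | ω n = 0}) ⟨n, h⟩

theorem ne_zero_of_lt_firstZero {ω : ℕ → Fin m} {n : ℕ} (h : n < firstZero ω) : ω n ≠ 0 :=
  Nat.notMem_of_lt_sInf (s := {n | ω n = 0}) h

theorem firstZero_le {ω : ℕ → Fin m} {n : ℕ} (h : ω n = 0) : firstZero ω ≤ n :=
  Nat.sInf_le (s := {n | ω n = 0}) h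

theorem firstZero_eq_zero {ω : ℕ → Fin m} (h : ω 0 = 0) : firstZero ω = 0 :=
  Nat.le_zero.1 (firstZero_le h)

theorem firstZero_eq_iff {ω : ℕ → Fin m} {n k : ℕ} (h : ω n = 0) :
    firstZero ω = k ↔ ω k = 0 ∧ ∀ j < k, ω j ≠ 0 := by
  constructor
  · rintro rfl
    exact ⟨apply_firstZero h, fun j hj => ne_zero_of_lt_firstZero hj⟩
  · rintro ⟨h1, h2⟩
    refine le_antisymm (firstZero_le h1) ?_
    by_contra! h3
    exact h2 _ h3 (apply_firstZero h)

theorem firstZero_eq_zero_of_forall {ω : ℕ → Fin m} (h : ∀ n, ω n ≠ 0) : firstZero ω = 0 := by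
  have : {n | ω n = 0} = ∅ := Set.eq_empty_of_forall_notMem h
  rw [firstZero, this, Nat.sInf_empty]

theorem firstZero_eq_succ {ω : ℕ → Fin m} {n : ℕ} (h0 : ω 0 ≠ 0) (h : shift ω n = 0) :
    firstZero ω = firstZero (shift ω) + 1 := by
  rw [firstZero_eq_iff (n := n + 1) h]
  refine ⟨apply_firstZero h, fun j hj => ?_⟩
  cases j with
  | zero => exact h0
  | succ j => exact ne_zero_of_lt_firstZero (ω := shift ω) (Nat.lt_of_succ_lt_succ hj)

/-- The default value 0 is what makes this hold without recurrence: if `shift ω` has no zero, then ω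
has none or has one only at index 0, and `firstZero ω` is 0 in both cases. -/
theorem firstZero_le_succ {ω : ℕ → Fin m} : firstZero ω ≤ firstZero (shift ω) + 1 := by
  by_cases h0 : ω 0 = 0
  · simp [firstZero_eq_zero h0]
  by_cases h : ∃ n, shift ω n = 0
  · exact (firstZero_eq_succ h0 h.choose_spec).le
  · push Not at h
    have : ∀ n, ω n ≠ 0 := by
      intro n
      cases n with
      | zero => exact h0
      | succ n => exact h n
    simp [firstZero_eq_zero_of_forall this]

theorem measurable_firstZero : Measurable (firstZero : (ℕ → Fin m) → ℕ) := by
  refine measurable_to_countable' fun k => ?_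
  have hex : MeasurableSet {ω : ℕ → Fin m | ∃ n, ω n = 0} := by
    simp only [Set.ofPred_exists]
    exact MeasurableSet.iUnion fun n => measurableSet_apply_eq n 0
  have hk : MeasurableSet {ω : ℕ → Fin m | ω k = 0 ∧ ∀ j < k, ω j ≠ 0} := by
    have : {ω : ℕ → Fin m | ω k = 0 ∧ ∀ j < k, ω j ≠ 0}
        = {ω | ω k = 0} ∩ ⋂ j, ⋂ (_ : j < k), {ω | ω j = 0}ᶜ := by
      ext ω; simp
    rw [this]
    exact (measurableSet_apply_eq k 0).inter <| MeasurableSet.iInter fun j =>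
      MeasurableSet.iInter fun _ => (measurableSet_apply_eq j 0).compl
  -- The second piece collects the sequences without a zero, which take the default value 0.
  have : firstZero ⁻¹' {k} = ({ω : ℕ → Fin m | ∃ n, ω n = 0} ∩
      {ω | ω k = 0 ∧ ∀ j < k, ω j ≠ 0}) ∪ ({ω | ∃ n, ω n = 0}ᶜ ∩ {_ω | 0 = k}) := by
    ext ω
    by_cases h : ∃ n, ω n = 0
    · simp only [Set.mem_preimage, Set.mem_singleton_iff, firstZero_eq_iff h.choose_spec]
      simp [h]
    · have h' := h
      push Not at h'
      simp only [Set.mem_preimage, Set.mem_singleton_iff, firstZero_eq_zero_of_forall h']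
      simp [h]
  rw [this]
  exact (hex.inter hk).union (hex.compl.inter (MeasurableSet.const _))

/-- The word between the letter `0` at index `0` and the next letter `0`. -/
noncomputable def returnWord (ω : ℕ → Fin m) : List (Fin m) :=
  prefixWord (shift ω) (firstZero (shift ω))

instance instMeasurableSpaceListFin : MeasurableSpace (List (Fin m)) := ⊤

instance instDiscreteMeasurableSpaceListFin : DiscreteMeasurableSpace (List (Fin m)) :=
  ⟨fun _ => trivial⟩

theorem zero_notMem_returnWord (ω : ℕ → Fin m) : 0 ∉ returnWord ω := by
  rw [returnWord, mem_prefixWord]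
  rintro ⟨k, hk, h⟩
  exact ne_zero_of_lt_firstZero hk h

theorem measurable_returnWord : Measurable (returnWord : (ℕ → Fin m) → List (Fin m)) := by
  refine measurable_to_countable' fun w => ?_
  have : returnWord ⁻¹' {w} = shift ⁻¹'
      ({ω : ℕ → Fin m | prefixWord ω w.length = w} ∩ firstZero ⁻¹' {w.length}) := by
    ext ω
    simp only [Set.mem_preimage, Set.mem_singleton_iff, Set.mem_inter_iff, Set.mem_ofPred_eq,
      returnWord]
    constructor
    · intro h
      have h2 : firstZero (shift ω) = w.length := by rw [← h, length_prefixWord]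
      exact ⟨h2 ▸ h, h2⟩
    · rintro ⟨h1, h2⟩
      rw [h2, h1]
  rw [this]
  exact measurable_shift ((measurableSet_prefixWord_eq _ _).inter
    (measurable_firstZero (measurableSet_singleton _)))

theorem returnWord_eq_iff {ω : ℕ → Fin m} {w : List (Fin m)} (hw : 0 ∉ w) {n : ℕ}
    (h : shift ω n = 0) :
    returnWord ω = w ↔ prefixWord (shift ω) w.length = w ∧ shift ω w.length = 0 := by
  constructor
  · rintro rfl
    refine ⟨by simp [returnWord], ?_⟩
    rw [returnWord, length_prefixWord]
    exact apply_firstZero h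
  · rintro ⟨h1, h2⟩
    have : firstZero (shift ω) = w.length := by
      rw [firstZero_eq_iff h2]
      refine ⟨h2, fun j hj h0 => hw ?_⟩
      rw [← h1, mem_prefixWord]
      exact ⟨j, hj, h0⟩
    rw [returnWord, this, h1]

/-- The function that is `g` of the return word on the cylinder `[0]`, and `0` elsewhere. -/
noncomputable def atReturn (g : List (Fin m) → ℝ) : (ℕ → Fin m) → ℝ :=
  (wordCylinder [(0 : Fin m)]).indicator fun ω => g (returnWord ω)

theorem atReturn_of_eq (g : List (Fin m) → ℝ) {ω : ℕ → Fin m} (h : ω 0 = 0) :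
    atReturn g ω = g (returnWord ω) :=
  Set.indicator_of_mem (mem_wordCylinder_zero.2 h) _

theorem atReturn_of_ne (g : List (Fin m) → ℝ) {ω : ℕ → Fin m} (h : ω 0 ≠ 0) :
    atReturn g ω = 0 :=
  Set.indicator_of_notMem (fun h' => h (mem_wordCylinder_zero.1 h')) _

theorem measurable_atReturn (g : List (Fin m) → ℝ) : Measurable (atReturn g) :=
  ((Measurable.of_discrete (f := g)).comp measurable_returnWord).indicator
    measurableSet_wordCylinder_zero

/-- The distribution of the return word on the cylinder `[0]`. -/
noncomputable def returnMeasure (μ : Measure (ℕ → Fin m)) : Measure (List (Fin m)) :=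
  (μ.restrict (wordCylinder [0])).map returnWord

instance instIsFiniteMeasureReturnMeasure (μ : Measure (ℕ → Fin m)) [IsFiniteMeasure μ] :
    IsFiniteMeasure (returnMeasure μ) := by
  unfold returnMeasure; infer_instance

theorem integrable_atReturn_iff {μ : Measure (ℕ → Fin m)} {g : List (Fin m) → ℝ} :
    Integrable (atReturn g) μ ↔ Integrable g (returnMeasure μ) := by
  rw [atReturn, integrable_indicator_iff measurableSet_wordCylinder_zero, returnMeasure,
    integrable_map_measure Measurable.of_discrete.aestronglyMeasurable
      measurable_returnWord.aemeasurable]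
  rfl

theorem integral_atReturn {μ : Measure (ℕ → Fin m)} (g : List (Fin m) → ℝ) :
    ∫ ω, atReturn g ω ∂μ = ∫ w, g w ∂(returnMeasure μ) := by
  rw [atReturn, integral_indicator measurableSet_wordCylinder_zero, returnMeasure,
    integral_map measurable_returnWord.aemeasurable Measurable.of_discrete.aestronglyMeasurable]

theorem returnMeasure_apply (μ : Measure (ℕ → Fin m)) (s : Set (List (Fin m))) :
    returnMeasure μ s = μ (returnWord ⁻¹' s ∩ wordCylinder [0]) := by
  rw [returnMeasure, Measure.map_apply measurable_returnWord trivial,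
    Measure.restrict_apply (measurable_returnWord trivial)]

theorem returnMeasure_univ (μ : Measure (ℕ → Fin m)) :
    returnMeasure μ Set.univ = μ (wordCylinder [0]) := by
  rw [returnMeasure_apply, Set.preimage_univ, Set.univ_inter]

theorem returnMeasure_singleton_of_mem (μ : Measure (ℕ → Fin m)) {w : List (Fin m)}
    (hw : 0 ∈ w) : returnMeasure μ {w} = 0 := by
  rw [returnMeasure_apply]
  have : returnWord ⁻¹' {w} = (∅ : Set (ℕ → Fin m)) := by
    refine Set.eq_empty_of_forall_notMem fun ω h => zero_notMem_returnWord ω ?_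
    rw [Set.mem_preimage, Set.mem_singleton_iff] at h
    rwa [h]
  rw [this, Set.empty_inter, measure_empty]

/-- Recurrence is needed: when no further zero occurs, the return word takes the default value `[]`
although ω need not lie in [00]. -/
theorem returnMeasure_singleton {μ : Measure (ℕ → Fin m)}
    (hrec : ∀ᵐ ω ∂μ, ∃ n, shift ω n = 0) {w : List (Fin m)} (hw : 0 ∉ w) :
    returnMeasure μ {w} = μ (wordCylinder (zeroWrap w)) := by
  rw [returnMeasure_apply]
  refine measure_congr ?_
  filter_upwards [hrec] with ω ⟨n, hn⟩
  refine propext ?_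
  change ω ∈ returnWord ⁻¹' {w} ∩ wordCylinder [0] ↔ ω ∈ wordCylinder (zeroWrap w)
  rw [Set.mem_inter_iff, Set.mem_preimage, Set.mem_singleton_iff, returnWord_eq_iff hw hn,
    mem_wordCylinder_zero, mem_wordCylinder_zeroWrap, and_comm]

/-- Kac's bound for the lengths of the return words. -/
theorem lintegral_length_returnMeasure_le {μ : Measure (ℕ → Fin m)} [IsProbabilityMeasure μ]
    (hμ : MeasurePreserving shift μ μ) :
    ∫⁻ w, ((w.length + 1 : ℕ) : ENNReal) ∂(returnMeasure μ) ≤ 1 := by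
  have hbound : ∀ K : ℕ, ∫⁻ w, ((min w.length K + 1 : ℕ) : ENNReal) ∂(returnMeasure μ) ≤ 1 := by
    intro K
    -- With h the hitting time of 0 truncated at K, the integrand on [0] plus h is at most 1 + h ∘
    -- shift pointwise. Truncation makes ∫ h finite, so it cancels by invariance; monotone
    -- convergence then removes K.
    set h : (ℕ → Fin m) → ENNReal := fun ω => ((min (firstZero ω) K : ℕ) : ENNReal) with hh
    have hm : Measurable h :=
      (Measurable.of_discrete (f := fun n : ℕ => ((min n K : ℕ) : ENNReal))).comp
        measurable_firstZero
    have hfin : ∫⁻ ω, h ω ∂μ ≠ ⊤ := by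
      refine ne_top_of_le_ne_top (b := ∫⁻ _, (K : ENNReal) ∂μ) (by simp) (lintegral_mono fun ω => ?_)
      exact Nat.cast_le.2 (min_le_right _ _)
    have hcomp : ∫⁻ ω, h (shift ω) ∂μ = ∫⁻ ω, h ω ∂μ := hμ.lintegral_comp hm
    rw [returnMeasure, lintegral_map Measurable.of_discrete measurable_returnWord,
      ← lintegral_indicator measurableSet_wordCylinder_zero]
    refine (ENNReal.add_le_add_iff_right hfin).1 ?_
    rw [← lintegral_add_right _ hm]
    calc _ ≤ ∫⁻ ω, (1 + h (shift ω)) ∂μ := by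
          refine lintegral_mono fun ω => ?_
          by_cases h0 : ω 0 = 0
          · simp only [Set.indicator_of_mem (mem_wordCylinder_zero.2 h0), hh, returnWord,
              length_prefixWord, firstZero_eq_zero h0]
            simp [add_comm]
          · rw [Set.indicator_of_notMem fun h' => h0 (mem_wordCylinder_zero.1 h')]
            simp only [hh, zero_add]
            have := firstZero_le_succ (ω := ω)
            exact_mod_cast (by omega :
              min (firstZero ω) K ≤ 1 + min (firstZero (shift ω)) K)
      _ = 1 + ∫⁻ ω, h ω ∂μ := by
          rw [lintegral_add_left measurable_const, hcomp]
          simp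
  have hsup : ∀ w : List (Fin m), ((w.length + 1 : ℕ) : ENNReal)
      = ⨆ K : ℕ, ((min w.length K + 1 : ℕ) : ENNReal) := by
    intro w
    refine le_antisymm (le_iSup_of_le w.length (by simp)) (iSup_le fun K => ?_)
    exact Nat.cast_le.2 (by omega)
  simp_rw [hsup]
  rw [lintegral_iSup (fun _ => Measurable.of_discrete)]
  · exact iSup_le hbound
  · intro K K' hK w
    exact Nat.cast_le.2 (by omega)

theorem integrable_length_returnMeasure {μ : Measure (ℕ → Fin m)} [IsProbabilityMeasure μ]
    (hμ : MeasurePreserving shift μ μ) :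
    Integrable (fun w : List (Fin m) => (w.length : ℝ) + 1) (returnMeasure μ) := by
  refine ⟨Measurable.of_discrete.aestronglyMeasurable, ?_⟩
  refine lt_of_le_of_lt ?_
    ((lintegral_length_returnMeasure_le hμ).trans_lt ENNReal.one_lt_top)
  refine lintegral_mono fun w => le_of_eq ?_
  rw [Real.enorm_eq_ofReal (by positivity)]
  change ENNReal.ofReal ((w.length : ℝ) + 1) = _
  rw [← Nat.cast_succ, ENNReal.ofReal_natCast]

end Words

/-! ### Norm bounds for matrix products and the collapse at the rank-one matrix. -/

section MatrixProducts

/-- Linear maps of a finite-dimensional space are bounded with respect to any norm. -/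
theorem Seminorm.exists_apply_le_mul {E : Type*} [AddCommGroup E] [Module ℂ E]
    [FiniteDimensional ℂ E] (N : Seminorm ℂ E) (hN : ∀ x, N x = 0 → x = 0) (T : E →ₗ[ℂ] E) :
    ∃ C : ℝ, ∀ x, N (T x) ≤ C * N x := by
  let : Norm E := ⟨N⟩
  have core : NormedSpace.Core ℂ E :=
    { norm_nonneg := fun x => apply_nonneg N x
      norm_smul := fun c x => map_smul_eq_mul N c x
      norm_triangle := fun x y => map_add_le_add N x y
      norm_eq_zero_iff := fun x => ⟨hN x, fun h => by rw [h]; exact map_zero N⟩ }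
  let : NormedAddCommGroup E := NormedAddCommGroup.ofCore core
  let : NormedSpace ℂ E := NormedSpace.ofCore core
  exact ⟨‖LinearMap.toContinuousLinearMap T‖, (LinearMap.toContinuousLinearMap T).le_opNorm⟩

variable {m d : ℕ} {A : Fin m → Matrix (Fin d) (Fin d) ℂ}

theorem wordProd_append (w w' : List (Fin m)) :
    wordProd A (w ++ w') = wordProd A w * wordProd A w' := by
  simp [wordProd]

theorem wordProd_cons (j : Fin m) (w : List (Fin m)) :
    wordProd A (j :: w) = A j * wordProd A w := by
  simp [wordProd]

theorem wordProd_nil : wordProd A [] = 1 := rfl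

theorem mul_wordProd_le {N : Seminorm ℂ (Matrix (Fin d) (Fin d) ℂ)} {C : ℝ} (hC : 0 ≤ C)
    (h : ∀ j X, N (X * A j) ≤ C * N X) (w : List (Fin m)) (X : Matrix (Fin d) (Fin d) ℂ) :
    N (X * wordProd A w) ≤ C ^ w.length * N X := by
  induction w generalizing X with
  | nil => simp [wordProd_nil]
  | cons j w ih =>
    rw [wordProd_cons, ← mul_assoc, List.length_cons, pow_succ, mul_assoc (C ^ _)]
    exact (ih _).trans (mul_le_mul_of_nonneg_left (h j X) (by positivity))

variable [NeZero m]

/-- One constant serves for right multiplication by every `A j` and, when j ≠ 0, by its inverse. The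
formal inverse of a singular `A 0` also enters the sum, harmlessly, since it only enlarges C. -/
theorem exists_mul_bounds (N : Seminorm ℂ (Matrix (Fin d) (Fin d) ℂ))
    (hN : ∀ B, N B = 0 → B = 0) (hA : ∀ j : Fin m, j ≠ 0 → IsUnit (A j)) :
    ∃ C : ℝ, 1 ≤ C ∧ (∀ j X, N (X * A j) ≤ C * N X) ∧
      ∀ j : Fin m, j ≠ 0 → ∀ X, N X ≤ C * N (X * A j) := by
  have h : ∀ B : Matrix (Fin d) (Fin d) ℂ, ∃ c : ℝ, ∀ X, N (X * B) ≤ c * N X := fun B =>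
    N.exists_apply_le_mul hN (LinearMap.mulRight ℂ B)
  choose c hc using h
  have hnn : ∀ j, 0 ≤ |c (A j)| + |c (A j)⁻¹| := fun j => by positivity
  have hle : ∀ j, |c (A j)| + |c (A j)⁻¹| ≤ 1 + ∑ j, (|c (A j)| + |c (A j)⁻¹|) := fun j => by
    have := Finset.single_le_sum (fun i _ => hnn i) (Finset.mem_univ j)
    linarith
  refine ⟨1 + ∑ j, (|c (A j)| + |c (A j)⁻¹|), ?_, fun j X => ?_, fun j hj X => ?_⟩
  · linarith [Finset.sum_nonneg fun j (_ : j ∈ Finset.univ) => hnn j]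
  · refine (hc (A j) X).trans (mul_le_mul_of_nonneg_right ?_ (apply_nonneg N X))
    linarith [hle j, le_abs_self (c (A j)), abs_nonneg (c (A j)⁻¹)]
  · have hinv : X * A j * (A j)⁻¹ = X := by
      rw [mul_assoc, Matrix.mul_nonsing_inv _ ((Matrix.isUnit_iff_isUnit_det _).1 (hA j hj)),
        mul_one]
    have := hc (A j)⁻¹ (X * A j)
    rw [hinv] at this
    refine this.trans (mul_le_mul_of_nonneg_right ?_ (apply_nonneg N _))
    linarith [hle j, le_abs_self (c (A j)⁻¹), abs_nonneg (c (A j))]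

theorem le_mul_wordProd {N : Seminorm ℂ (Matrix (Fin d) (Fin d) ℂ)} {C : ℝ} (hC : 0 ≤ C)
    (h : ∀ j : Fin m, j ≠ 0 → ∀ X, N X ≤ C * N (X * A j)) {w : List (Fin m)} (hw : 0 ∉ w)
    (X : Matrix (Fin d) (Fin d) ℂ) :
    N X ≤ C ^ w.length * N (X * wordProd A w) := by
  induction w generalizing X with
  | nil => simp [wordProd_nil]
  | cons j w ih =>
    rw [List.mem_cons, not_or] at hw
    rw [wordProd_cons, ← mul_assoc, List.length_cons, pow_succ', mul_assoc C]
    exact (h j (Ne.symm hw.1) X).trans (mul_le_mul_of_nonneg_left (ih hw.2 _) hC)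

theorem isUnit_wordProd (hA : ∀ j : Fin m, j ≠ 0 → IsUnit (A j)) {w : List (Fin m)}
    (hw : 0 ∉ w) : IsUnit (wordProd A w) := by
  induction w with
  | nil => exact isUnit_one
  | cons j w ih =>
    rw [List.mem_cons, not_or] at hw
    rw [wordProd_cons]
    exact (hA j (Ne.symm hw.1)).mul (ih hw.2)

/-- The vector `A_w u`, where `w` is the prefix of `ω` up to its first letter `0`. -/
noncomputable def zeroVec (A : Fin m → Matrix (Fin d) (Fin d) ℂ) (u : Fin d → ℂ)
    (ω : ℕ → Fin m) : Fin d → ℂ :=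
  (wordProd A (prefixWord ω (firstZero ω))).mulVec u

/-- The multiplicative cocycle which describes the action of the matrices on `zeroVec`. -/
noncomputable def zeroCocycle (A : Fin m → Matrix (Fin d) (Fin d) ℂ) (u v : Fin d → ℂ)
    (ω : ℕ → Fin m) : ℂ :=
  if ω 0 = 0 then v ⬝ᵥ (wordProd A (returnWord ω)).mulVec u else 1

variable {u v : Fin d → ℂ}

theorem zeroVec_of_eq {ω : ℕ → Fin m} (h : ω 0 = 0) : zeroVec A u ω = u := by
  rw [zeroVec, firstZero_eq_zero h]
  exact Matrix.one_mulVec u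

theorem zeroVec_ne_zero (hA : ∀ j : Fin m, j ≠ 0 → IsUnit (A j)) (hu : u ≠ 0) (ω : ℕ → Fin m) :
    zeroVec A u ω ≠ 0 := by
  have hw : 0 ∉ prefixWord ω (firstZero ω) := by
    rw [mem_prefixWord]
    rintro ⟨k, hk, h⟩
    exact ne_zero_of_lt_firstZero hk h
  have := Matrix.mulVec_injective_of_isUnit (isUnit_wordProd hA hw)
  intro h
  exact hu (this (by rw [Matrix.mulVec_zero]; exact h))

/-- Away from 0 the new letter just extends the word up to the first zero, so the factor is 1. At a
zero, u v' sends the vector to a multiple of u, and the multiplier is v' A_w u for the return word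
w. -/
theorem mulVec_zeroVec_shift (hA0 : A 0 = Matrix.vecMulVec u v) {ω : ℕ → Fin m} {n : ℕ}
    (h : shift ω n = 0) :
    (A (ω 0)).mulVec (zeroVec A u (shift ω)) = zeroCocycle A u v ω • zeroVec A u ω := by
  by_cases h0 : ω 0 = 0
  · rw [zeroCocycle, if_pos h0, zeroVec_of_eq h0, h0, hA0, Matrix.vecMulVec_mulVec]
    rw [zeroVec, returnWord]
    ext i
    simp [mul_comm]
  · rw [zeroCocycle, if_neg h0, one_smul, zeroVec, zeroVec, firstZero_eq_succ h0 h,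
      prefixWord_succ, wordProd_cons, Matrix.mulVec_mulVec]

theorem wordProd_prefixWord_mulVec (hA0 : A 0 = Matrix.vecMulVec u v) {ω : ℕ → Fin m} {t : ℕ}
    (h : ω t = 0) :
    (wordProd A (prefixWord ω t)).mulVec u =
      (∏ k ∈ Finset.range t, zeroCocycle A u v (shift^[k] ω)) • zeroVec A u ω := by
  induction t generalizing ω with
  | zero => rw [zeroVec_of_eq h]; simp [prefixWord, wordProd_nil]
  | succ t ih =>
    have h' : shift ω t = 0 := h
    rw [prefixWord_succ, wordProd_cons, ← Matrix.mulVec_mulVec, ih h', Matrix.mulVec_smul,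
      mulVec_zeroVec_shift hA0 h', smul_smul, Finset.prod_range_succ']
    simp only [Function.iterate_succ_apply, Function.iterate_zero, id]

theorem wordProd_prefixWord_eq (hA0 : A 0 = Matrix.vecMulVec u v) {ω : ℕ → Fin m} {t n : ℕ}
    (h : ω t = 0) (htn : t < n) :
    wordProd A (prefixWord ω n) =
      (∏ k ∈ Finset.range t, zeroCocycle A u v (shift^[k] ω)) •
        (Matrix.vecMulVec (zeroVec A u ω) v *
          wordProd A (prefixWord (shift^[t + 1] ω) (n - (t + 1)))) := by
  obtain ⟨r, rfl⟩ := Nat.exists_eq_add_of_lt htn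
  have h1 : prefixWord ω (t + r + 1) = prefixWord ω t ++ prefixWord (shift^[t] ω) (r + 1) := by
    rw [add_assoc, prefixWord_add]
  have h2 : shift^[t] ω 0 = 0 := by rw [iterate_shift_apply, zero_add, h]
  rw [h1, prefixWord_succ, wordProd_append, wordProd_cons, h2, hA0, ← mul_assoc,
    Matrix.mul_vecMulVec, wordProd_prefixWord_mulVec hA0 h, Matrix.smul_vecMulVec,
    Matrix.smul_mul, Function.iterate_succ_apply']
  congr 4
  omega

/-- The scalar by which `A₀ A_w A₀` differs from `A₀` grows at most exponentially. -/
theorem norm_dotProduct_wordProd_le (hA0 : A 0 = Matrix.vecMulVec u v) (hne : A 0 ≠ 0)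
    {N : Seminorm ℂ (Matrix (Fin d) (Fin d) ℂ)} (hN : ∀ B, N B = 0 → B = 0) {C : ℝ} (hC : 0 ≤ C)
    (h : ∀ j X, N (X * A j) ≤ C * N X) (w : List (Fin m)) :
    ‖v ⬝ᵥ (wordProd A w).mulVec u‖ ≤ C ^ (w.length + 1) := by
  have hpos : 0 < N (A 0) := lt_of_le_of_ne (apply_nonneg N _) fun h0 => hne (hN _ h0.symm)
  have hprod : A 0 * wordProd A (w ++ [0]) = (v ⬝ᵥ (wordProd A w).mulVec u) • A 0 := by
    rw [wordProd_append, wordProd_cons, wordProd_nil, mul_one, hA0, Matrix.mul_vecMulVec,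
      Matrix.vecMulVec_mul_vecMulVec, Matrix.vecMulVec_smul]
  have := mul_wordProd_le hC h (w ++ [0]) (A 0)
  rw [hprod, map_smul_eq_mul, List.length_append, List.length_singleton] at this
  exact le_of_mul_le_mul_right this hpos

end MatrixProducts

/-! ### Frequency of zeros and the position of the last zero. -/

section LastZero

variable {m : ℕ} [NeZero m]

/-- The indicator function of the cylinder `[0]`. -/
noncomputable abbrev zeroIndicator : (ℕ → Fin m) → ℝ := atReturn fun _ => 1

theorem birkhoffSum_zeroIndicator_eq {ω : ℕ → Fin m} {a b : ℕ} (hab : a ≤ b)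
    (h : ∀ k, a ≤ k → k < b → ω k ≠ 0) :
    birkhoffSum shift zeroIndicator b ω = birkhoffSum shift zeroIndicator a ω := by
  induction b, hab using Nat.le_induction with
  | base => rfl
  | succ b hab ih =>
    have h0 : shift^[b] ω 0 ≠ 0 := by
      rw [iterate_shift_apply, zero_add]
      exact h b hab b.lt_succ_self
    rw [birkhoffSum_succ, show zeroIndicator (shift^[b] ω) = 0 from atReturn_of_ne _ h0, add_zero]
    exact ih fun k hk hkb => h k hk (hkb.trans b.lt_succ_self)

/-- If no zero occurred from K on, the count of zeros would freeze and their frequency would be 0.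
-/
theorem exists_zero_ge {ω : ℕ → Fin m} {p : ℝ} (hp : 0 < p)
    (hz : Tendsto (fun n : ℕ => birkhoffSum shift zeroIndicator n ω / n) atTop (𝓝 p)) (K : ℕ) :
    ∃ n, K ≤ n ∧ ω n = 0 := by
  by_contra! h
  have h0 : Tendsto (fun n : ℕ => birkhoffSum shift zeroIndicator n ω / n) atTop (𝓝 0) := by
    refine (tendsto_const_div_atTop_nhds_zero_nat
      (birkhoffSum shift zeroIndicator K ω)).congr' ?_
    filter_upwards [eventually_ge_atTop K] with n hn
    rw [birkhoffSum_zeroIndicator_eq hn fun k hk _ => h k hk]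
  exact hp.ne (tendsto_nhds_unique h0 hz)

/-- The index of the last letter `0` among the first `n` letters of `ω`. -/
def lastZero (ω : ℕ → Fin m) (n : ℕ) : ℕ := Nat.findGreatest (fun k => ω k = 0) (n - 1)

theorem le_lastZero {ω : ℕ → Fin m} {k n : ℕ} (hk : ω k = 0) (hkn : k < n) :
    k ≤ lastZero ω n :=
  Nat.le_findGreatest (Nat.le_sub_one_of_lt hkn) hk

theorem apply_lastZero {ω : ℕ → Fin m} {k n : ℕ} (hk : ω k = 0) (hkn : k < n) :
    ω (lastZero ω n) = 0 :=
  Nat.findGreatest_spec (P := fun k => ω k = 0) (Nat.le_sub_one_of_lt hkn) hk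

theorem lastZero_lt {ω : ℕ → Fin m} {n : ℕ} (hn : 0 < n) : lastZero ω n < n :=
  lt_of_le_of_lt (Nat.findGreatest_le _) (Nat.sub_one_lt_of_lt hn)

theorem ne_zero_of_lastZero_lt {ω : ℕ → Fin m} {k n : ℕ} (hk : lastZero ω n < k) (hkn : k < n) :
    ω k ≠ 0 := fun h => hk.not_ge (le_lastZero h hkn)

theorem tendsto_lastZero {ω : ℕ → Fin m} (h : ∀ K, ∃ n, K ≤ n ∧ ω n = 0) :
    Tendsto (lastZero ω) atTop atTop := by
  refine tendsto_atTop.2 fun K => ?_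
  obtain ⟨k, hk, h0⟩ := h K
  filter_upwards [eventually_gt_atTop k] with n hn
  exact hk.trans (le_lastZero h0 hn)

/-- Let t be the last zero before n. The zero counts up to n and up to t + 1 agree, and both
averages tend to p > 0, so (t + 1)/n → 1. -/
theorem tendsto_lastZero_div {ω : ℕ → Fin m} {p : ℝ} (hp : 0 < p)
    (hz : Tendsto (fun n : ℕ => birkhoffSum shift zeroIndicator n ω / n) atTop (𝓝 p)) :
    Tendsto (fun n : ℕ => (lastZero ω n : ℝ) / n) atTop (𝓝 1) := by
  have ht := tendsto_lastZero (exists_zero_ge hp hz)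
  have h1 : Tendsto (fun n : ℕ => (birkhoffSum shift zeroIndicator n ω / n) /
      (birkhoffSum shift zeroIndicator (lastZero ω n + 1) ω / ((lastZero ω n + 1 : ℕ) : ℝ)))
      atTop (𝓝 (p / p)) :=
    hz.div (hz.comp ((tendsto_add_atTop_nat 1).comp ht)) hp.ne'
  -- The quotient in `h1` is eventually (t + 1)/n; subtracting 1/n leaves t/n.
  have h2 := h1.sub tendsto_one_div_atTop_nhds_zero_nat
  rw [div_self hp.ne', sub_zero] at h2
  refine h2.congr' ?_
  filter_upwards [eventually_gt_atTop 0, hz.eventually_ne hp.ne'] with n hn hne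
  have hS : birkhoffSum shift zeroIndicator n ω
      = birkhoffSum shift zeroIndicator (lastZero ω n + 1) ω :=
    birkhoffSum_zeroIndicator_eq (lastZero_lt hn) fun k hk hkn =>
      ne_zero_of_lastZero_lt hk hkn
  have hne' : birkhoffSum shift zeroIndicator n ω ≠ 0 := fun h => hne (by rw [h, zero_div])
  have hn' : (n : ℝ) ≠ 0 := Nat.cast_ne_zero.2 hn.ne'
  rw [← hS]
  push_cast
  have : (lastZero ω n : ℝ) + 1 ≠ 0 := by positivity
  field_simp
  ring

/-- Stopping at the last zero does not change the limit, and an error linear in n - t plus a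
constant is o(n). In the applications a is ±log C and b is the logarithm of the norm of the initial
factor. -/
theorem tendsto_birkhoffSum_lastZero {ω : ℕ → Fin m} {p : ℝ} (hp : 0 < p)
    (hz : Tendsto (fun n : ℕ => birkhoffSum shift zeroIndicator n ω / n) atTop (𝓝 p))
    {f : (ℕ → Fin m) → ℝ} {I : ℝ}
    (hf : Tendsto (fun n : ℕ => birkhoffSum shift f n ω / n) atTop (𝓝 I)) (a b : ℝ) :
    Tendsto (fun n : ℕ => (birkhoffSum shift f (lastZero ω n) ω + (n - lastZero ω n) * a + b) / n)
      atTop (𝓝 I) := by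
  have ht := tendsto_lastZero (exists_zero_ge hp hz)
  have hd := tendsto_lastZero_div hp hz
  have h1 := (((hf.comp ht).mul hd).add ((hd.const_sub 1).mul_const a)).add
    (tendsto_const_div_atTop_nhds_zero_nat b)
  simp only [mul_one, sub_self, zero_mul, add_zero] at h1
  refine h1.congr' ?_
  filter_upwards [eventually_gt_atTop 0, ht.eventually_gt_atTop 0] with n hn hn1
  have hn' : (n : ℝ) ≠ 0 := Nat.cast_ne_zero.2 hn.ne'
  have hn1' : (lastZero ω n : ℝ) ≠ 0 := Nat.cast_ne_zero.2 hn1.ne'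
  simp only [Function.comp_apply]
  field_simp

end LastZero

/-! ### Comparison of the extended logarithm with real exponents. -/

section Elog

theorem elog_le_coe {x b : ℝ} (h : x ≤ Real.exp b) : elog x ≤ b := by
  have : ENNReal.log (ENNReal.ofReal (Real.exp b)) = b := by
    rw [ENNReal.log_ofReal_of_pos (Real.exp_pos b), Real.log_exp]
  rw [elog, ← this]
  exact ENNReal.log_monotone (ENNReal.ofReal_le_ofReal h)

theorem coe_le_elog {x b : ℝ} (h : Real.exp b ≤ x) : (b : EReal) ≤ elog x := by
  have : ENNReal.log (ENNReal.ofReal (Real.exp b)) = b := by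
    rw [ENNReal.log_ofReal_of_pos (Real.exp_pos b), Real.log_exp]
  rw [elog, ← this]
  exact ENNReal.log_monotone (ENNReal.ofReal_le_ofReal h)

theorem elog_of_pos {x : ℝ} (h : 0 < x) : elog x = (Real.log x : EReal) :=
  ENNReal.log_ofReal_of_pos h

theorem elog_div_le {x b : ℝ} {n : ℕ} (h : x ≤ Real.exp b) : elog x / (n : EReal) ≤ (b / n : ℝ) := by
  rw [EReal.coe_div]
  exact EReal.monotone_div_right_of_nonneg (Nat.cast_nonneg' n) (elog_le_coe h)

theorem le_elog_div {x b : ℝ} {n : ℕ} (h : Real.exp b ≤ x) : ((b / n : ℝ) : EReal) ≤ elog x / n := by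
  rw [EReal.coe_div]
  exact EReal.monotone_div_right_of_nonneg (Nat.cast_nonneg' n) (coe_le_elog h)

end Elog

/-! ### Two-sided exponential bounds for the norm of the products. -/

section Growth

variable {m d : ℕ} [NeZero m] {A : Fin m → Matrix (Fin d) (Fin d) ℂ} {u v : Fin d → ℂ}
  {N : Seminorm ℂ (Matrix (Fin d) (Fin d) ℂ)} {ω : ℕ → Fin m}

theorem apply_wordProd_prefixWord_eq (hA0 : A 0 = Matrix.vecMulVec u v) {n k : ℕ} (hk : ω k = 0)
    (hkn : k < n) :
    N (wordProd A (prefixWord ω n)) =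
      (∏ k ∈ Finset.range (lastZero ω n), ‖zeroCocycle A u v (shift^[k] ω)‖) *
        N (Matrix.vecMulVec (zeroVec A u ω) v *
          wordProd A (prefixWord (shift^[lastZero ω n + 1] ω) (n - (lastZero ω n + 1)))) := by
  rw [wordProd_prefixWord_eq hA0 (apply_lastZero hk hkn) (lastZero_lt (k.zero_le.trans_lt hkn)),
    map_smul_eq_mul, norm_prod]

theorem pow_le_exp_mul_log {C : ℝ} (hC : 1 ≤ C) {k n : ℕ} (hkn : k < n) :
    C ^ (n - (k + 1)) ≤ Real.exp ((n - k) * Real.log C) := by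
  rw [← Nat.cast_sub hkn.le, mul_comm, Real.exp_mul, Real.exp_log (by linarith), Real.rpow_natCast]
  exact pow_le_pow_right₀ hC (by omega)

theorem apply_wordProd_prefixWord_le (hA0 : A 0 = Matrix.vecMulVec u v) {C : ℝ} (hC : 1 ≤ C)
    (hup : ∀ j X, N (X * A j) ≤ C * N X) (hpos : 0 < N (Matrix.vecMulVec (zeroVec A u ω) v))
    {f : (ℕ → Fin m) → ℝ}
    (hf : ∀ k, ‖zeroCocycle A u v (shift^[k] ω)‖ ≤ Real.exp (f (shift^[k] ω)))
    {n k : ℕ} (hk : ω k = 0) (hkn : k < n) :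
    N (wordProd A (prefixWord ω n)) ≤ Real.exp (birkhoffSum shift f (lastZero ω n) ω +
      (n - lastZero ω n) * Real.log C +
        Real.log (N (Matrix.vecMulVec (zeroVec A u ω) v))) := by
  rw [apply_wordProd_prefixWord_eq hA0 hk hkn, add_assoc, Real.exp_add, Real.exp_add,
    Real.exp_log hpos, birkhoffSum, Real.exp_sum]
  refine mul_le_mul (Finset.prod_le_prod (fun _ _ => norm_nonneg _) fun k _ => hf k) ?_
    (apply_nonneg N _) (Finset.prod_nonneg fun _ _ => (Real.exp_pos _).le)
  refine (mul_wordProd_le (by linarith) hup _ _).trans ?_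
  rw [length_prefixWord]
  exact mul_le_mul_of_nonneg_right
    (pow_le_exp_mul_log hC (lastZero_lt (k.zero_le.trans_lt hkn))) hpos.le

theorem le_apply_wordProd_prefixWord (hA0 : A 0 = Matrix.vecMulVec u v) {C : ℝ} (hC : 1 ≤ C)
    (hlow : ∀ j : Fin m, j ≠ 0 → ∀ X, N X ≤ C * N (X * A j))
    (hpos : 0 < N (Matrix.vecMulVec (zeroVec A u ω) v)) {f : (ℕ → Fin m) → ℝ}
    (hf : ∀ k, Real.exp (f (shift^[k] ω)) ≤ ‖zeroCocycle A u v (shift^[k] ω)‖)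
    {n k : ℕ} (hk : ω k = 0) (hkn : k < n) :
    Real.exp (birkhoffSum shift f (lastZero ω n) ω + (n - lastZero ω n) * -Real.log C +
      Real.log (N (Matrix.vecMulVec (zeroVec A u ω) v))) ≤ N (wordProd A (prefixWord ω n)) := by
  rw [apply_wordProd_prefixWord_eq hA0 hk hkn, add_assoc, Real.exp_add, Real.exp_add,
    Real.exp_log hpos, birkhoffSum, Real.exp_sum, mul_neg, Real.exp_neg]
  refine mul_le_mul (Finset.prod_le_prod (fun _ _ => (Real.exp_pos _).le) fun k _ => hf k) ?_
    (by positivity) (Finset.prod_nonneg fun _ _ => norm_nonneg _)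
  -- After the last zero only invertible matrices occur, so the tail can be undone at a cost of at
  -- most C per letter.
  have hs : 0 ∉ prefixWord (shift^[lastZero ω n + 1] ω) (n - (lastZero ω n + 1)) := by
    rw [mem_prefixWord]
    rintro ⟨i, hi, h0⟩
    rw [iterate_shift_apply] at h0
    exact ne_zero_of_lastZero_lt (n := n) (by omega) (by omega) h0
  rw [inv_mul_le_iff₀ (Real.exp_pos _)]
  refine (le_mul_wordProd (by linarith) hlow hs _).trans ?_
  rw [length_prefixWord]
  exact mul_le_mul_of_nonneg_right
    (pow_le_exp_mul_log hC (lastZero_lt (k.zero_le.trans_lt hkn))) (apply_nonneg N _)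

theorem eventually_elog_div_le (hA0 : A 0 = Matrix.vecMulVec u v) {C : ℝ} (hC : 1 ≤ C)
    (hup : ∀ j X, N (X * A j) ≤ C * N X) (hpos : 0 < N (Matrix.vecMulVec (zeroVec A u ω) v))
    {p : ℝ} (hp : 0 < p)
    (hz : Tendsto (fun n : ℕ => birkhoffSum shift zeroIndicator n ω / n) atTop (𝓝 p))
    {f : (ℕ → Fin m) → ℝ} {I : ℝ}
    (hlim : Tendsto (fun n : ℕ => birkhoffSum shift f n ω / n) atTop (𝓝 I))
    (hf : ∀ k, ‖zeroCocycle A u v (shift^[k] ω)‖ ≤ Real.exp (f (shift^[k] ω)))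
    {b : ℝ} (hb : I < b) :
    ∀ᶠ n : ℕ in atTop, elog (N (wordProd A (prefixWord ω n))) / (n : EReal) < b := by
  obtain ⟨k, -, hk⟩ := exists_zero_ge hp hz 0
  filter_upwards [eventually_gt_atTop k, (tendsto_birkhoffSum_lastZero hp hz hlim (Real.log C)
    (Real.log (N (Matrix.vecMulVec (zeroVec A u ω) v)))).eventually_lt_const hb] with n hn hlt
  exact (elog_div_le (apply_wordProd_prefixWord_le hA0 hC hup hpos hf hk hn)).trans_lt
    (EReal.coe_lt_coe_iff.2 hlt)

theorem eventually_lt_elog_div (hA0 : A 0 = Matrix.vecMulVec u v) {C : ℝ} (hC : 1 ≤ C)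
    (hlow : ∀ j : Fin m, j ≠ 0 → ∀ X, N X ≤ C * N (X * A j))
    (hpos : 0 < N (Matrix.vecMulVec (zeroVec A u ω) v)) {p : ℝ} (hp : 0 < p)
    (hz : Tendsto (fun n : ℕ => birkhoffSum shift zeroIndicator n ω / n) atTop (𝓝 p))
    {f : (ℕ → Fin m) → ℝ} {I : ℝ}
    (hlim : Tendsto (fun n : ℕ => birkhoffSum shift f n ω / n) atTop (𝓝 I))
    (hf : ∀ k, Real.exp (f (shift^[k] ω)) ≤ ‖zeroCocycle A u v (shift^[k] ω)‖)
    {b : ℝ} (hb : b < I) :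
    ∀ᶠ n : ℕ in atTop, (b : EReal) < elog (N (wordProd A (prefixWord ω n))) / (n : EReal) := by
  obtain ⟨k, -, hk⟩ := exists_zero_ge hp hz 0
  filter_upwards [eventually_gt_atTop k, (tendsto_birkhoffSum_lastZero hp hz hlim (-Real.log C)
    (Real.log (N (Matrix.vecMulVec (zeroVec A u ω) v)))).eventually_const_lt hb] with n hn hlt
  exact (EReal.coe_lt_coe_iff.2 hlt).trans_le
    (le_elog_div (le_apply_wordProd_prefixWord hA0 hC hlow hpos hf hk hn))

end Growth

/-! ### Integrals over return words as unconditional sums. -/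

section ReturnSums

/-- The coercion from the reals to the extended reals, as an additive homomorphism. -/
noncomputable def coeERealHom : ℝ →+ EReal where
  toFun := fun x => x
  map_zero' := EReal.coe_zero
  map_add' := EReal.coe_add

theorem hasSum_coe_ereal {ι : Type*} {f : ι → ℝ} {a : ℝ} (h : HasSum f a) :
    HasSum (fun i => (f i : EReal)) (a : EReal) :=
  h.map coeERealHom continuous_coe_real_ereal

/-- Terms bounded by summable real families with arbitrarily small sums have the sum `-∞`. -/
theorem hasSum_ereal_bot {ι : Type*} {x : ι → EReal} {f : ℕ → ι → ℝ} {a : ℕ → ℝ}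
    (hx : ∀ M i, x i ≤ f M i) (hf : ∀ M, HasSum (f M) (a M)) (ha : Tendsto a atTop atBot) :
    HasSum x ⊥ := by
  refine EReal.tendsto_nhds_bot_iff_real.2 fun y => ?_
  obtain ⟨M, hM⟩ := (ha.eventually_lt_atBot y).exists
  filter_upwards [(hf M).eventually_lt_const hM] with s hs
  calc ∑ i ∈ s, x i ≤ ∑ i ∈ s, (f M i : EReal) := Finset.sum_le_sum fun i _ => hx M i
    _ = ((∑ i ∈ s, f M i : ℝ) : EReal) := (map_sum coeERealHom (f M) s).symm
    _ < y := EReal.coe_lt_coe_iff.2 hs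

variable {m : ℕ} [NeZero m] {μ : Measure (ℕ → Fin m)}

/-- The words form a countable discrete space, so the measure is a weighted sum of Dirac masses. -/
theorem hasSum_returnMeasure {g : List (Fin m) → ℝ} (hg : Integrable g (returnMeasure μ)) :
    HasSum (fun w => (returnMeasure μ).real {w} * g w) (∫ w, g w ∂(returnMeasure μ)) := by
  have h := hasSum_integral_measure (f := g)
    (μ := fun w => returnMeasure μ {w} • Measure.dirac w) (by rwa [Measure.sum_smul_dirac])
  rw [Measure.sum_smul_dirac] at h
  simp only [integral_smul_measure, integral_dirac, smul_eq_mul] at h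
  exact h

theorem support_subset_returnWords (hrec : ∀ᵐ ω ∂μ, ∃ n, shift ω n = 0)
    (g : List (Fin m) → ℝ) :
    Function.support (fun w => (returnMeasure μ).real {w} * g w) ⊆ returnWords μ := by
  intro w hw
  have h0 : returnMeasure μ {w} ≠ 0 := by
    intro h0
    exact hw (by simp [Measure.real, h0])
  have hmem : 0 ∉ w := fun h => h0 (returnMeasure_singleton_of_mem μ h)
  rw [returnMeasure_singleton hrec hmem] at h0
  exact ⟨hmem, pos_iff_ne_zero.2 h0⟩

theorem returnMeasure_real_singleton (hrec : ∀ᵐ ω ∂μ, ∃ n, shift ω n = 0)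
    (w : returnWords μ) :
    (returnMeasure μ).real {(w : List (Fin m))}
      = μ.real (wordCylinder (zeroWrap (w : List (Fin m)))) := by
  rw [Measure.real, returnMeasure_singleton hrec w.2.1, Measure.real]

theorem hasSum_returnWords (hrec : ∀ᵐ ω ∂μ, ∃ n, shift ω n = 0) {g : List (Fin m) → ℝ}
    (hg : Integrable g (returnMeasure μ)) :
    HasSum (fun w : returnWords μ => μ.real (wordCylinder (zeroWrap (w : List (Fin m)))) * g w)
      (∫ w, g w ∂(returnMeasure μ)) := by
  have h := (hasSum_subtype_iff_of_support_subset (support_subset_returnWords hrec g)).2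
    (hasSum_returnMeasure hg)
  simpa only [Function.comp_def, returnMeasure_real_singleton hrec] using h

theorem integrable_of_summable_returnWords [IsFiniteMeasure μ]
    (hrec : ∀ᵐ ω ∂μ, ∃ n, shift ω n = 0) {g : List (Fin m) → ℝ}
    (hg : Summable fun w : returnWords μ =>
      μ.real (wordCylinder (zeroWrap (w : List (Fin m)))) * |g w|) :
    Integrable g (returnMeasure μ) := by
  have h : Summable fun w => (returnMeasure μ).real {w} * |g w| := by
    refine ((Subtype.val_injective (p := (· ∈ returnWords μ))).summable_iff fun w hw => ?_).1 ?_
    · rw [Subtype.range_val] at hw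
      exact Function.notMem_support.1
        fun h => hw (support_subset_returnWords hrec (fun w => |g w|) h)
    simpa only [Function.comp_def, returnMeasure_real_singleton hrec] using hg
  rw [← Measure.sum_smul_dirac (returnMeasure μ)]
  exact integrable_sum_dirac (fun w => measure_ne_top _ _) h

theorem returnMeasure_eq_zero (hrec : ∀ᵐ ω ∂μ, ∃ n, shift ω n = 0) {s : Set (List (Fin m))}
    (hs : ∀ w ∈ returnWords μ, w ∉ s) : returnMeasure μ s = 0 := by
  rw [← Set.biUnion_of_singleton s, measure_biUnion_null_iff s.to_countable]
  intro w hw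
  by_contra h0
  have hmem : 0 ∉ w := fun h => h0 (returnMeasure_singleton_of_mem μ h)
  rw [returnMeasure_singleton hrec hmem] at h0
  exact hs w ⟨hmem, pos_iff_ne_zero.2 h0⟩ hw

theorem returnWords_real_pos [IsFiniteMeasure μ] (w : returnWords μ) :
    0 < μ.real (wordCylinder (zeroWrap (w : List (Fin m)))) :=
  ENNReal.toReal_pos w.2.2.ne' (measure_ne_top _ _)

end ReturnSums

/-! ### Truncated logarithms and the integrability dichotomy. -/

section TruncatedLog

/-- The logarithm, truncated from below at `-M`. -/
noncomputable def truncLog (M : ℕ) (x : ℝ) : ℝ := Real.log (max x (Real.exp (-M)))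

theorem exp_truncLog (M : ℕ) (x : ℝ) : Real.exp (truncLog M x) = max x (Real.exp (-M)) :=
  Real.exp_log (lt_max_of_lt_right (Real.exp_pos _))

theorem truncLog_anti {M M' : ℕ} (h : M ≤ M') (x : ℝ) : truncLog M' x ≤ truncLog M x := by
  refine Real.log_le_log (lt_max_of_lt_right (Real.exp_pos _)) (max_le_max le_rfl ?_)
  exact Real.exp_le_exp.2 (neg_le_neg (Nat.cast_le.2 h))

theorem neg_le_truncLog (M : ℕ) (x : ℝ) : -(M : ℝ) ≤ truncLog M x :=
  (Real.le_log_iff_exp_le (lt_max_of_lt_right (Real.exp_pos _))).2 (le_max_right _ _)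

theorem truncLog_le {M : ℕ} {x b : ℝ} (hb : 0 ≤ b) (h : x ≤ Real.exp b) : truncLog M x ≤ b := by
  refine (Real.log_le_iff_le_exp (lt_max_of_lt_right (Real.exp_pos _))).2 (max_le h ?_)
  exact Real.exp_le_exp.2 ((neg_nonpos.2 M.cast_nonneg).trans hb)

theorem truncLog_zero (M : ℕ) : truncLog M 0 = -M := by
  rw [truncLog, max_eq_right (Real.exp_pos _).le, Real.log_exp]

theorem log_le_truncLog {x : ℝ} (hx : 0 < x) (M : ℕ) : Real.log x ≤ truncLog M x :=
  Real.log_le_log hx (le_max_left _ _)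

theorem tendsto_truncLog {x : ℝ} (hx : 0 < x) :
    Tendsto (fun M => truncLog M x) atTop (𝓝 (Real.log x)) := by
  have h1 : Tendsto (fun M : ℕ => Real.exp (-(M : ℝ))) atTop (𝓝 0) :=
    Real.tendsto_exp_neg_atTop_nhds_zero.comp tendsto_natCast_atTop_atTop
  have h2 := (tendsto_const_nhds (x := x)).max h1
  rw [max_eq_left hx.le] at h2
  exact h2.log hx.ne'

variable {m : ℕ} [NeZero m] {μ : Measure (ℕ → Fin m)} [IsProbabilityMeasure μ]

theorem integrable_truncLog (hμ : MeasurePreserving shift μ μ) {γ : List (Fin m) → ℝ} {C : ℝ}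
    (hC : 1 ≤ C) (hγ : ∀ w, γ w ≤ C ^ (w.length + 1)) (M : ℕ) :
    Integrable (fun w => truncLog M (γ w)) (returnMeasure μ) := by
  refine Integrable.mono' (((integrable_length_returnMeasure hμ).mul_const (Real.log C)).add
    (integrable_const (M : ℝ))) Measurable.of_discrete.aestronglyMeasurable
    (Eventually.of_forall fun w => ?_)
  have hlog := Real.log_nonneg hC
  have hb : 0 ≤ ((w.length : ℝ) + 1) * Real.log C := by positivity
  have h1 : truncLog M (γ w) ≤ ((w.length : ℝ) + 1) * Real.log C := by
    refine truncLog_le hb ((hγ w).trans (le_of_eq ?_))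
    rw [mul_comm, Real.exp_mul, Real.exp_log (by linarith), ← Nat.cast_succ, Real.rpow_natCast]
  have h2 := neg_le_truncLog M (γ w)
  have hM : (0 : ℝ) ≤ M := M.cast_nonneg
  rw [Real.norm_eq_abs, abs_le]
  simp only [Pi.add_apply]
  constructor <;> linarith

/-- If the integrals of the truncated logarithms are bounded below, then the logarithm itself is
finite on the return words and integrable. -/
theorem pos_and_integrable_log (hrec : ∀ᵐ ω ∂μ, ∃ n, shift ω n = 0)
    {γ : List (Fin m) → ℝ} (hγ0 : ∀ w, 0 ≤ γ w)
    (hint : ∀ M, Integrable (fun w => truncLog M (γ w)) (returnMeasure μ))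
    (hbot : ¬ Tendsto (fun M => ∫ w, truncLog M (γ w) ∂(returnMeasure μ)) atTop atBot) :
    (∀ w ∈ returnWords μ, 0 < γ w) ∧ Integrable (fun w => Real.log (γ w)) (returnMeasure μ) := by
  have hanti : Antitone fun M => ∫ w, truncLog M (γ w) ∂(returnMeasure μ) := fun M M' h =>
    integral_mono (hint M') (hint M) fun w => truncLog_anti h (γ w)
  obtain ⟨l, hl⟩ := (tendsto_atTop_of_antitone hanti).resolve_left hbot
  -- The truncated integrals decrease to l, so D bounds the total loss from level 0 to any level M,
  -- uniformly in M and in finite sets of words.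
  set D := ∫ w, truncLog 0 (γ w) ∂(returnMeasure μ) - l with hD
  have hsum : ∀ (M : ℕ) (s : Finset (returnWords μ)),
      ∑ w ∈ s, μ.real (wordCylinder (zeroWrap (w : List (Fin m)))) *
        (truncLog 0 (γ w) - truncLog M (γ w)) ≤ D := by
    intro M s
    have h1 := hasSum_returnWords hrec ((hint 0).sub (hint M))
    refine (sum_le_hasSum s (fun w _ => mul_nonneg measureReal_nonneg ?_) h1).trans ?_
    · exact sub_nonneg.2 (truncLog_anti M.zero_le _)
    · simp only [Pi.sub_apply]
      rw [integral_sub (hint 0) (hint M)]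
      have := hanti.le_of_tendsto hl M
      linarith
  have hpos : ∀ w ∈ returnWords μ, 0 < γ w := by
    intro w hw
    refine lt_of_le_of_ne (hγ0 w) fun h0 => ?_
    have hp := returnWords_real_pos ⟨w, hw⟩
    -- If γ w = 0, the loss at w alone is M times its mass, which exceeds D for large M.
    obtain ⟨M, hM⟩ := exists_nat_gt (D / μ.real (wordCylinder (zeroWrap w)))
    have := hsum M {⟨w, hw⟩}
    rw [Finset.sum_singleton, ← h0, truncLog_zero, truncLog_zero] at this
    rw [div_lt_iff₀ hp] at hM
    push_cast at this
    linarith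
  refine ⟨hpos, ?_⟩
  have hnn : ∀ w : returnWords μ, 0 ≤ truncLog 0 (γ w) - Real.log (γ w) := fun w =>
    sub_nonneg.2 (log_le_truncLog (hpos w w.2) 0)
  have hlog : Integrable (fun w => truncLog 0 (γ w) - Real.log (γ w)) (returnMeasure μ) := by
    refine integrable_of_summable_returnWords hrec ?_
    simp_rw [abs_of_nonneg (hnn _)]
    refine summable_of_sum_le (c := D) (fun w => mul_nonneg measureReal_nonneg (hnn w))
      fun s => ?_
    -- On a fixed finite set of words the truncations converge to the logarithm, so the bound D
    -- survives the limit M → ∞.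
    refine le_of_tendsto' (x := atTop) (tendsto_finsetSum s fun w _ => ?_) fun M => hsum M s
    exact ((tendsto_truncLog (hpos w w.2)).const_sub _).const_mul _
  have := (hint 0).sub hlog
  simpa only [Pi.sub_def, sub_sub_cancel] using this

end TruncatedLog

/-! ### The cocycle as an exponential along orbits, and the conclusion. -/

section Main

variable {m d : ℕ} [NeZero m] {A : Fin m → Matrix (Fin d) (Fin d) ℂ} {u v : Fin d → ℂ}
  {μ : Measure (ℕ → Fin m)}

theorem integral_zeroIndicator : ∫ ω, zeroIndicator ω ∂μ = μ.real (wordCylinder [0]) := by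
  rw [integral_atReturn, integral_const, smul_eq_mul, mul_one, Measure.real, returnMeasure_univ,
    Measure.real]

theorem Ergodic.ae_tendsto_zeroIndicator [IsProbabilityMeasure μ] (hμ : Ergodic shift μ) :
    ∀ᵐ ω ∂μ, Tendsto (fun n : ℕ => birkhoffSum shift zeroIndicator n ω / n) atTop
      (𝓝 (μ.real (wordCylinder [0]))) := by
  have h := hμ.ae_tendsto_birkhoffSum_div (measurable_atReturn fun _ => 1)
    (integrable_atReturn_iff.2 (integrable_const 1))
  rwa [integral_zeroIndicator] at h

theorem norm_zeroCocycle_of_eq {ω : ℕ → Fin m} (h : ω 0 = 0) :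
    ‖zeroCocycle A u v ω‖ = ‖v ⬝ᵥ (wordProd A (returnWord ω)).mulVec u‖ := by
  rw [zeroCocycle, if_pos h]

theorem norm_zeroCocycle_of_ne {ω : ℕ → Fin m} (h : ω 0 ≠ 0) : ‖zeroCocycle A u v ω‖ = 1 := by
  rw [zeroCocycle, if_neg h, norm_one]

theorem norm_zeroCocycle_le_exp_truncLog (M : ℕ) (ω : ℕ → Fin m) :
    ‖zeroCocycle A u v ω‖ ≤ Real.exp
      (atReturn (fun w => truncLog M ‖v ⬝ᵥ (wordProd A w).mulVec u‖) ω) := by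
  by_cases h : ω 0 = 0
  · rw [norm_zeroCocycle_of_eq h, atReturn_of_eq _ h, exp_truncLog]
    exact le_max_left _ _
  · rw [norm_zeroCocycle_of_ne h, atReturn_of_ne _ h, Real.exp_zero]

theorem ae_exp_log_eq_norm_zeroCocycle (hμ : MeasurePreserving shift μ μ)
    (hrec : ∀ᵐ ω ∂μ, ∃ n, shift ω n = 0)
    (hpos : ∀ w ∈ returnWords μ, 0 < ‖v ⬝ᵥ (wordProd A w).mulVec u‖) :
    ∀ᵐ ω ∂μ, ∀ k, Real.exp
      (atReturn (fun w => Real.log ‖v ⬝ᵥ (wordProd A w).mulVec u‖) (shift^[k] ω)) =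
        ‖zeroCocycle A u v (shift^[k] ω)‖ := by
  -- `Real.log 0 = 0` breaks the identity where the scalar vanishes, but such return words carry no
  -- mass.
  have h0 : returnMeasure μ {w | ¬ 0 < ‖v ⬝ᵥ (wordProd A w).mulVec u‖} = 0 :=
    returnMeasure_eq_zero hrec fun w hw h => h (hpos w hw)
  have h1 : ∀ᵐ ω ∂μ, Real.exp
      (atReturn (fun w => Real.log ‖v ⬝ᵥ (wordProd A w).mulVec u‖) ω) =
        ‖zeroCocycle A u v ω‖ := by
    rw [returnMeasure_apply] at h0
    filter_upwards [measure_eq_zero_iff_ae_notMem.1 h0] with ω hω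
    by_cases h : ω 0 = 0
    · rw [norm_zeroCocycle_of_eq h, atReturn_of_eq _ h, Real.exp_log]
      by_contra hneg
      exact hω ⟨hneg, mem_wordCylinder_zero.2 h⟩
    · rw [norm_zeroCocycle_of_ne h, atReturn_of_ne _ h, Real.exp_zero]
  exact ae_all_iff.2 fun k => (hμ.iterate k).quasiMeasurePreserving.ae h1

end Main

theorem mainTheorem3 (m d : ℕ) [NeZero m] (A : Fin m → Matrix (Fin d) (Fin d) ℂ)
    (u v : Fin d → ℂ) (hA0 : A 0 = Matrix.vecMulVec u v) (hvu : v ⬝ᵥ u ≠ 0)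
    (hA : ∀ j : Fin m, j ≠ 0 → IsUnit (A j))
    (N : Seminorm ℂ (Matrix (Fin d) (Fin d) ℂ)) (hN : ∀ B, N B = 0 → B = 0)
    (μ : Measure (ℕ → Fin m)) [IsProbabilityMeasure μ] (hμ : Ergodic shift μ)
    (hμ0 : 0 < μ (wordCylinder [0])) :
    ∃ S : EReal,
      HasSum (fun w : returnWords μ =>
        (μ.real (wordCylinder (zeroWrap (w : List (Fin m)))) : EReal) *
          elog (‖v ⬝ᵥ (wordProd A (w : List (Fin m))).mulVec u‖ / ‖v ⬝ᵥ u‖)) S ∧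
      S ≠ ⊤ ∧
      ∀ᵐ ω ∂μ, HasLyapunovExponent N A ω
        ((μ.real (wordCylinder [0]) : EReal) * elog ‖v ⬝ᵥ u‖ + S) := by
  have hmp := hμ.toMeasurePreserving
  have hp : 0 < μ.real (wordCylinder [(0 : Fin m)]) :=
    ENNReal.toReal_pos hμ0.ne' (measure_ne_top _ _)
  have hu : u ≠ 0 := fun h => hvu (by rw [h, dotProduct_zero])
  have hv : v ≠ 0 := fun h => hvu (by rw [h, zero_dotProduct])
  have hA0ne : A 0 ≠ 0 := by rw [hA0]; exact Matrix.vecMulVec_ne_zero hu hv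
  have hc : 0 < ‖v ⬝ᵥ u‖ := norm_pos_iff.2 hvu
  obtain ⟨C, hC, hup, hlow⟩ := exists_mul_bounds N hN hA
  have hfreq := hμ.ae_tendsto_zeroIndicator
  have hrec : ∀ᵐ ω ∂μ, ∃ n, shift ω n = 0 := by
    filter_upwards [hfreq] with ω hω
    -- An index at least 1, so that the zero is one of `shift ω`.
    obtain ⟨n, hn, h0⟩ := exists_zero_ge hp hω 1
    obtain ⟨k, rfl⟩ := Nat.exists_eq_add_of_le' hn
    exact ⟨k, h0⟩
  have hNpos : ∀ ω : ℕ → Fin m, 0 < N (Matrix.vecMulVec (zeroVec A u ω) v) := fun ω =>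
    lt_of_le_of_ne (apply_nonneg N _) fun h =>
      Matrix.vecMulVec_ne_zero (zeroVec_ne_zero hA hu ω) hv (hN _ h.symm)
  set γ : List (Fin m) → ℝ := fun w => ‖v ⬝ᵥ (wordProd A w).mulVec u‖ with hγ
  have hint : ∀ M, Integrable (fun w => truncLog M (γ w)) (returnMeasure μ) := fun M =>
    integrable_truncLog hmp hC
      (norm_dotProduct_wordProd_le hA0 hA0ne hN (by linarith) hup) M
  have hmass : ∫ _, Real.log ‖v ⬝ᵥ u‖ ∂(returnMeasure μ)
      = μ.real (wordCylinder [0]) * Real.log ‖v ⬝ᵥ u‖ := by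
    rw [integral_const, smul_eq_mul, Measure.real, returnMeasure_univ, Measure.real]
  by_cases hbot : Tendsto (fun M => ∫ w, truncLog M (γ w) ∂(returnMeasure μ)) atTop atBot
  -- The truncated logarithms dominate from above, and their integrals bound both the series and the
  -- exponent by arbitrarily negative numbers.
  · refine ⟨⊥, ?_, bot_ne_top, ?_⟩
    · refine hasSum_ereal_bot (fun M w => ?_)
        (fun M => hasSum_returnWords hrec ((hint M).sub (integrable_const (Real.log ‖v ⬝ᵥ u‖)))) ?_
      · rw [EReal.coe_mul]
        refine mul_le_mul_of_nonneg_left (elog_le_coe ?_)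
          (EReal.coe_nonneg.2 measureReal_nonneg)
        rw [Pi.sub_apply, Real.exp_sub, exp_truncLog, Real.exp_log hc]
        exact div_le_div_of_nonneg_right (le_max_left _ _) hc.le
      · simp only [Pi.sub_apply]
        simp_rw [integral_sub (hint _) (integrable_const (Real.log ‖v ⬝ᵥ u‖)), sub_eq_add_neg]
        exact tendsto_atBot_add_const_right _ _ hbot
    · have hB : ∀ M, ∀ᵐ ω ∂μ, Tendsto (fun n : ℕ =>
          birkhoffSum shift (atReturn fun w => truncLog M (γ w)) n ω / n) atTop
          (𝓝 (∫ w, truncLog M (γ w) ∂(returnMeasure μ))) := fun M => by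
        rw [← integral_atReturn]
        exact hμ.ae_tendsto_birkhoffSum_div (measurable_atReturn _)
          (integrable_atReturn_iff.2 (hint M))
      filter_upwards [hfreq, ae_all_iff.2 hB] with ω hω hBω
      rw [EReal.add_bot, HasLyapunovExponent, EReal.tendsto_nhds_bot_iff_real]
      intro y
      obtain ⟨M, hM⟩ := (hbot.eventually_lt_atBot y).exists
      exact eventually_elog_div_le hA0 hC hup (hNpos ω) hp hω (hBω M)
        (fun k => norm_zeroCocycle_le_exp_truncLog M _) hM
  · obtain ⟨hpos, hlog⟩ := pos_and_integrable_log hrec (fun w => norm_nonneg _) hint hbot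
    set J := ∫ w, Real.log (γ w) ∂(returnMeasure μ) with hJ
    -- Each return word contributes -log|v'u| to the series, and the masses add up to μ([0]); this
    -- is exactly compensated by the first term of the formula, leaving J.
    refine ⟨((J - μ.real (wordCylinder [0]) * Real.log ‖v ⬝ᵥ u‖ : ℝ) : EReal), ?_,
      EReal.coe_ne_top _, ?_⟩
    · have h := hasSum_coe_ereal
        (hasSum_returnWords hrec (hlog.sub (integrable_const (Real.log ‖v ⬝ᵥ u‖))))
      simp only [Pi.sub_apply] at h
      rw [integral_sub hlog (integrable_const _), hmass] at h
      convert h using 2 with w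
      rw [EReal.coe_mul, elog_of_pos (div_pos (hpos w w.2) hc),
        Real.log_div (hpos w w.2).ne' hc.ne']
    · have hB := hμ.ae_tendsto_birkhoffSum_div (measurable_atReturn fun w => Real.log (γ w))
        (integrable_atReturn_iff.2 hlog)
      rw [integral_atReturn] at hB
      have hL : ((μ.real (wordCylinder [(0 : Fin m)]) : EReal) * elog ‖v ⬝ᵥ u‖ +
          ((J - μ.real (wordCylinder [0]) * Real.log ‖v ⬝ᵥ u‖ : ℝ) : EReal)) = (J : EReal) := by
        rw [elog_of_pos hc, ← EReal.coe_mul, ← EReal.coe_add]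
        congr 1
        ring
      rw [hL]
      filter_upwards [hfreq, hB, ae_exp_log_eq_norm_zeroCocycle hmp hrec hpos] with ω hω hBω hexp
      refine tendsto_order.2 ⟨fun a ha => ?_, fun b hb => ?_⟩
      · obtain ⟨y, hay, hyJ⟩ := EReal.lt_iff_exists_real_btwn.1 ha
        filter_upwards [eventually_lt_elog_div hA0 hC hlow (hNpos ω) hp hω hBω
          (fun k => (hexp k).le) (EReal.coe_lt_coe_iff.1 hyJ)] with n hn
        exact hay.trans hn
      · obtain ⟨y, hJy, hyb⟩ := EReal.lt_iff_exists_real_btwn.1 hb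
        filter_upwards [eventually_elog_div_le hA0 hC hup (hNpos ω) hp hω hBω
          (fun k => (hexp k).ge) (EReal.coe_lt_coe_iff.1 hJy)] with n hn
        exact hn.trans hyb
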